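/- Let $d,\bar s\ge 0$ be integers with $\bar s\le d/2$, and let $\beta_{\min},\omega,\sigma>0$ and $\delta\in(0,1)$. For a symmetric positive definite $d\times d$ matrix $\Sigma$ and $S,T\subseteq[d]=\{1,\dots,d\}$ write $\Sigma_{S\mid T}=\Sigma_{SS}-\Sigma_{ST}\Sigma_{TT}^{-1}\Sigma_{TS}$, and let $\mathrm{supp}(\beta)=\{j:\beta_j\neq 0\}$. Consider the model class $$\mathcal M=\Big\{(\beta,\Sigma,\sigma^2):\ |\mathrm{supp}(\beta)|\le\bar s,\ \min_{j\in\mathrm{supp}(\beta)}|\beta_j|\ge\beta_{\min},\ \Sigma\succ 0,\ \min_{|S|,|T|\le\bar s,\ S\not\subseteq T}\lambda_{\min}(\Sigma_{S\setminus T\mid T})\ge\omega\Big\}$$ (a minimum over the empty set is $+\infty$). For $(\beta,\Sigma,\sigma^2)\in\mathcal M$ let $P_{\beta,\Sigma,\sigma^2}$ be the law of $(x,y)$, where $x\sim\mathcal N(0,\Sigma)$ in $\mathbb R^d$, $\varepsilon\sim\mathcal N(0,\sigma^2)$ is independent of $x$, and $y=x^\top\beta+\varepsilon$. Given $n$ i.i.d.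 observations from $P_{\beta,\Sigma,\sigma^2}$, with design matrix $X\in\mathbb R^{n\times d}$ and response vector $Y\in\mathbb R^n$, let $\Pi_S$ be the orthogonal projection of $\mathbb R^n$ onto the span of the columns $X_S$ of $X$ indexed by $S$ (so $\Pi_S=X_S(X_S^\top X_S)^{-1}X_S^\top$ whenever $X_S^\top X_S$ is invertible), let $\Pi_S^\perp=I_n-\Pi_S$, and let the penalized best-subset estimator (BSSu) be any measurable choice $$\widehat S\in\operatorname*{arg\,min}_{S\subseteq[d],\ |S|\le\bar s}\ \frac{\|\Pi_S^\perp Y\|^2}{n-|S|}+|S|\,\tau,\qquad \tau=\tfrac14\,\omega\,\beta_{\min}^2 .$$ Theorem. There is a universal constant $C>0$ (independent of $d,\bar s,n,\beta_{\min},\omega,\sigma,\delta,\beta,\Sigma$ and of the choice of minimizer) such that, whenever $$n\ \ge\ C\max\left\{\frac{\log d+\log(1/\delta)}{\beta_{\min}^2\,\omega/\sigma^2},\ \log\binom{d}{\bar s}+\log(1/\delta)\right\},$$ every $(\beta,\Sigma,\sigma^2)\in\mathcal M$ satisfies $\mathbb P_{\beta,\Sigma,\sigma^2}\big(\widehat S=\mathrm{supp}(\beta)\big)\ge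 1-\delta$. (For $\bar s=0$, where $\widehat S=\mathrm{supp}(\beta)=\emptyset$, the statement is trivial, and conventions such as $\log 0=0$ are immaterial.) -/

import Mathlib

open MeasureTheory ProbabilityTheory
open scoped Matrix

noncomputable section

namespace BestSubset

/-- The support `{j : β j ≠ 0}` of a coefficient vector. -/
def supp {d : ℕ} (β : EuclideanSpace ℝ (Fin d)) : Finset (Fin d) :=
  Finset.univ.filter fun j => β j ≠ 0

/-- The smallest eigenvalue of a symmetric real matrix. The spectrum of a matrix is finite,
and that of a symmetric matrix with a nonempty index type is nonempty. -/
def lambdaMin {ι : Type*} [Fintype ι] [DecidableEq ι] (A : Matrix ι ι ℝ) : ℝ :=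
  sInf (spectrum ℝ A)

/-- The block of `A` with rows in `S` and columns in `T`. -/
def block {d : ℕ} (A : Matrix (Fin d) (Fin d) ℝ) (S T : Finset (Fin d)) : Matrix S T ℝ :=
  A.submatrix (fun i : S => (i : Fin d)) (fun j : T => (j : Fin d))

/-- The conditional covariance of the variables `S` given the variables `T`, namely
`Σ_SS - Σ_ST (Σ_TT)⁻¹ Σ_TS`. -/
def condCov {d : ℕ} (A : Matrix (Fin d) (Fin d) ℝ) (S T : Finset (Fin d)) : Matrix S S ℝ :=
  block A S S - block A S T * (block A T T)⁻¹ * block A T S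

/-- Coefficient vectors with at most `sbar` nonzero entries, all of them of absolute value at
least `βmin > 0`. -/
def coefClass (d sbar : ℕ) (βmin : ℝ) : Set (EuclideanSpace ℝ (Fin d)) :=
  {β | (supp β).card ≤ sbar ∧ (∀ j ∈ supp β, βmin ≤ |β j|) ∧ 0 < βmin}

/-- Positive definite covariance matrices such that, for all `S, T` with at most `sbar` elements
and `S` not contained in `T`, the conditional covariance of `S \ T` given `T` has smallest
eigenvalue at least `ω > 0`. -/
def covClass (d sbar : ℕ) (ω : ℝ) : Set (Matrix (Fin d) (Fin d) ℝ) :=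
  {A | A.PosDef ∧
    (∀ S T : Finset (Fin d), S.card ≤ sbar → T.card ≤ sbar → ¬ S ⊆ T →
      ω ≤ lambdaMin (condCov A (S \ T) T)) ∧ 0 < ω}

/-- The law of one observation `(x, y)` with `y = ⟨x, β⟩ + ε`, where `x ∼ N(0, A)` and
`ε ∼ N(0, σ²)` are independent. -/
def obsLaw {d : ℕ} (β : EuclideanSpace ℝ (Fin d)) (A : Matrix (Fin d) (Fin d) ℝ) (σ : ℝ) :
    Measure (EuclideanSpace ℝ (Fin d) × ℝ) :=
  ((multivariateGaussian 0 A).prod (gaussianReal 0 (σ ^ 2).toNNReal)).map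
    fun p => (p.1, inner ℝ p.1 β + p.2)

/-- The data set of `n` observations `(x_i, y_i)`. -/
abbrev Sample (n d : ℕ) : Type := Fin n → EuclideanSpace ℝ (Fin d) × ℝ

/-- The law of `n` independent observations. -/
def sampleLaw (n : ℕ) {d : ℕ} (β : EuclideanSpace ℝ (Fin d)) (A : Matrix (Fin d) (Fin d) ℝ)
    (σ : ℝ) : Measure (Sample n d) :=
  Measure.pi fun _ => obsLaw β A σ

/-- The `n × d` design matrix, whose rows are the observed covariate vectors. -/
def designMatrix {n d : ℕ} (z : Sample n d) : Matrix (Fin n) (Fin d) ℝ :=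
  Matrix.of fun i j => (z i).1 j

/-- The vector of the `n` observed responses. -/
def response {n d : ℕ} (z : Sample n d) : EuclideanSpace ℝ (Fin n) :=
  WithLp.toLp 2 fun i => (z i).2

/-- The span of the columns of `X` that are indexed by `S`. -/
def columnSpace {n d : ℕ} (X : Matrix (Fin n) (Fin d) ℝ) (S : Finset (Fin d)) :
    Submodule ℝ (EuclideanSpace ℝ (Fin n)) :=
  Submodule.span ℝ (Set.range fun j : S => WithLp.toLp 2 fun i => X i j)

/-- The projection `Π_S` onto the column space of `X_S`. -/
def proj {n d : ℕ} (X : Matrix (Fin n) (Fin d) ℝ) (S : Finset (Fin d)) :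
    EuclideanSpace ℝ (Fin n) →L[ℝ] EuclideanSpace ℝ (Fin n) :=
  (columnSpace X S).starProjection

/-- Whenever `X_Sᵀ X_S` is invertible, `Π_S = X_S (X_Sᵀ X_S)⁻¹ X_Sᵀ`. -/
theorem proj_eq {n d : ℕ} (X : Matrix (Fin n) (Fin d) ℝ) (S : Finset (Fin d))
    (XS : Matrix (Fin n) S ℝ) (hXS : XS = X.submatrix id (fun j : S => (j : Fin d)))
    (h : IsUnit (XSᵀ * XS).det) (y : EuclideanSpace ℝ (Fin n)) :
    proj X S y = WithLp.toLp 2 ((XS * (XSᵀ * XS)⁻¹ * XSᵀ) *ᵥ y.ofLp) := by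
  have hmem : ∀ c : S → ℝ, WithLp.toLp 2 (XS *ᵥ c) ∈ columnSpace X S := by
    intro c
    have : WithLp.toLp 2 (XS *ᵥ c)
        = ∑ j : S, c j • (WithLp.toLp 2 fun i => X i j : EuclideanSpace ℝ (Fin n)) := by
      ext i
      simp [Matrix.mulVec, dotProduct, hXS, mul_comm]
    rw [this]
    exact Submodule.sum_mem _ fun j _ =>
      Submodule.smul_mem _ _ (Submodule.subset_span ⟨j, rfl⟩)
  refine Submodule.eq_starProjection_of_mem_of_inner_eq_zero ?_ ?_
  · have := hmem (((XSᵀ * XS)⁻¹ * XSᵀ) *ᵥ y.ofLp)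
    rwa [Matrix.mulVec_mulVec, ← Matrix.mul_assoc] at this
  · have key : XSᵀ *ᵥ (y.ofLp - (XS * (XSᵀ * XS)⁻¹ * XSᵀ) *ᵥ y.ofLp) = 0 := by
      rw [Matrix.mulVec_sub, Matrix.mulVec_mulVec, ← Matrix.mul_assoc, ← Matrix.mul_assoc,
        Matrix.mul_nonsing_inv _ h, Matrix.one_mul, sub_self]
    intro w hw
    induction hw using Submodule.span_induction with
    | mem w hw =>
      obtain ⟨j, rfl⟩ := hw
      have := congrFun key j
      simpa [Matrix.mulVec, dotProduct, hXS, PiLp.inner_apply, mul_comm] using this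
    | zero => simp
    | add u v _ _ hu hv => rw [inner_add_right, hu, hv, add_zero]
    | smul a u _ hu => rw [inner_smul_right, hu, mul_zero]

/-- The penalized best-subset objective `‖Y - Π_S Y‖² / (n - |S|) + |S| τ`. -/
def objective {n d : ℕ} (τ : ℝ) (z : Sample n d) (S : Finset (Fin d)) : ℝ :=
  ‖response z - proj (designMatrix z) S (response z)‖ ^ 2 / ((n : ℝ) - S.card) + S.card * τ

/-- `Shat` is a penalized best-subset estimator (unknown sparsity): a measurable support
estimator that always minimizes the objective over all sets of at most `sbar` covariates.
Ties may be broken in any measurable way. -/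
def IsBSSu {n d : ℕ} (sbar : ℕ) (τ : ℝ) (Shat : Sample n d → Finset (Fin d)) : Prop :=
  Measurable Shat ∧ ∀ z, (Shat z).card ≤ sbar ∧
    ∀ S : Finset (Fin d), S.card ≤ sbar → objective τ z (Shat z) ≤ objective τ z S

end BestSubset

end

/-!
Fix the true support `S` and a candidate `T` with `|T| ≤ sbar`, and write `k = |S \ T|`,
`m = |T \ S|`, `r = k + m`. The objective values of `S` and `T` are compared after a split of the
response into three parts.

* `R`, the squared norm of the noise after removal of its projection on the columns in `S ∪ T`, is
  common to both fits and almost cancels; what remains comes from the different denominators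
  `n - |S|` and `n - |T|`.
  Without this cancellation the sample size would have to grow like `(σ² / ω βmin²)²`.
* `N`, the squared norm of the part of the noise in the span of the columns in `S ∪ T` orthogonal
  to the span of those in `S ∩ T`, has, given the design, the law of `σ²` times a chi-square variable
  with at most `r` degrees of freedom (`inputLaw_noise_overlap`). Giving `T` the failure
  probability `(δ / 6d) ^ r` makes the union bound a binomial sum (`sum_pow_card_symmDiff`), at the price of a bound on `N / n` of order
  `σ² r log(d / δ) / n`, which is a small fraction of `r τ`.
* `W`, the squared norm of the part of the signal that `T` misses: the residual of `⟨x, β⟩` in its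
  regression on the coordinates in `T` has variance at least `ω βmin² k` (`exists_residual_coef`) and
  is independent of these coordinates, so the chi-square lower tail gives
  `W ≥ ω βmin² k (n - |T|) / 2` (`inputLaw_signal_lt`), uniformly over at most `(d.choose sbar)²`
  candidates.

The cross term between signal and noise costs only a quarter of `W` and a multiple of `N`
(`sqDist_add_ge`). As `ω βmin² = 4 τ`, the gap between the two objective values is then at least
`r τ / 2` up to an error smaller than that (`objective_gap`), for all candidates at once.

All conditioning on the design is done by integration over a product measure. The events are
measurable because the squared distance of a vector to the span of a family has open sublevel sets
(`measurable_sqDist_span`), so that no rank condition on the design is needed.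
-/

namespace BestSubset

/-! ### Chi-square tails for projections of Gaussian vectors -/

/-- The standard Gaussian density tilted by `exp (t x²)` is again of Gaussian form. -/
lemma exp_mul_sq_mul_gaussianPDFReal (t x : ℝ) :
    gaussianPDFReal 0 1 x * Real.exp (t * x ^ 2)
      = (√(2 * Real.pi))⁻¹ * Real.exp (-(1 / 2 - t) * x ^ 2) := by
  rw [gaussianPDFReal]
  simp only [NNReal.coe_one, mul_one, sub_zero]
  rw [mul_assoc, ← Real.exp_add]
  ring_nf

lemma integrable_exp_mul_sq_gaussianReal {t : ℝ} (ht : t < 1 / 2) :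
    Integrable (fun x : ℝ => Real.exp (t * x ^ 2)) (gaussianReal 0 1) := by
  rw [gaussianReal_of_var_ne_zero 0 one_ne_zero,
    integrable_withDensity_iff_integrable_smul' (by fun_prop) (by simp [gaussianPDF_lt_top])]
  simp only [toReal_gaussianPDF, smul_eq_mul, exp_mul_sq_mul_gaussianPDFReal]
  exact (integrable_exp_neg_mul_sq (by linarith)).const_mul _

lemma integral_exp_mul_sq_gaussianReal {t : ℝ} (ht : t < 1 / 2) :
    ∫ x, Real.exp (t * x ^ 2) ∂(gaussianReal 0 1) = (√(1 - 2 * t))⁻¹ := by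
  rw [integral_gaussianReal_eq_integral_smul one_ne_zero]
  simp only [smul_eq_mul, exp_mul_sq_mul_gaussianPDFReal]
  rw [integral_const_mul, integral_gaussian, ← Real.sqrt_inv, ← Real.sqrt_inv,
    ← Real.sqrt_mul (by positivity)]
  congr 1
  have : 1 - 2 * t ≠ 0 := by linarith
  have h2 : 1 / 2 - t ≠ 0 := by linarith
  have := Real.pi_ne_zero
  field_simp

section stdGaussian

variable {E : Type*} [NormedAddCommGroup E] [InnerProductSpace ℝ E] [FiniteDimensional ℝ E]
  [MeasurableSpace E] [BorelSpace E]

/-- The moment generating function `(1 - 2t)^(-dim/2)` of the squared norm of a standard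
Gaussian vector. -/
lemma mgf_norm_sq_stdGaussian {t : ℝ} (ht : t < 1 / 2) :
    Integrable (fun x : E => Real.exp (t * ‖x‖ ^ 2)) (stdGaussian E) ∧
      mgf (fun x : E => ‖x‖ ^ 2) (stdGaussian E) t
        = (√(1 - 2 * t))⁻¹ ^ Module.finrank ℝ E := by
  have hmeas : Measurable (fun x : Fin (Module.finrank ℝ E) → ℝ =>
      ∑ i, x i • stdOrthonormalBasis ℝ E i) := by fun_prop
  have hnorm : ∀ x : Fin (Module.finrank ℝ E) → ℝ,
      Real.exp (t * ‖∑ i, x i • stdOrthonormalBasis ℝ E i‖ ^ 2) = ∏ i, Real.exp (t * x i ^ 2) := by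
    intro x
    rw [← Real.exp_sum, ← Finset.mul_sum, ← (stdOrthonormalBasis ℝ E).sum_sq_norm_inner_right]
    simp [inner_sum, inner_smul_right, OrthonormalBasis.inner_eq_ite]
  constructor
  · rw [stdGaussian, integrable_map_measure (by fun_prop) hmeas.aemeasurable]
    simp only [Function.comp_def]
    simp_rw [hnorm]
    exact Integrable.fintype_prod fun _ => integrable_exp_mul_sq_gaussianReal ht
  · rw [mgf, stdGaussian, integral_map hmeas.aemeasurable (by fun_prop)]
    simp_rw [hnorm]
    rw [integral_fintype_prod_eq_prod (f := fun _ x => Real.exp (t * x ^ 2))]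
    simp [integral_exp_mul_sq_gaussianReal ht]

/-- An orthogonal projection maps the standard Gaussian measure to that of its range. -/
lemma map_orthogonalProjectionOnto_stdGaussian (V : Submodule ℝ E) :
    (stdGaussian E).map V.orthogonalProjectionOnto = stdGaussian V := by
  have := Measure.isProbabilityMeasure_map (μ := stdGaussian E)
    (f := V.orthogonalProjectionOnto) (by fun_prop)
  apply Measure.ext_of_charFun
  ext t
  rw [charFun_apply, integral_map (by fun_prop) (by fun_prop)]
  have : ∀ x : E, inner ℝ (V.orthogonalProjectionOnto x) t = inner ℝ x (t : E) := by
    intro x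
    simp
  simp_rw [this]
  rw [← charFun_apply, charFun_stdGaussian, charFun_stdGaussian]
  simp

lemma mgf_norm_sq_starProjection_stdGaussian (V : Submodule ℝ E) {t : ℝ} (ht : t < 1 / 2) :
    Integrable (fun x : E => Real.exp (t * ‖V.starProjection x‖ ^ 2)) (stdGaussian E) ∧
      mgf (fun x : E => ‖V.starProjection x‖ ^ 2) (stdGaussian E) t
        = (√(1 - 2 * t))⁻¹ ^ Module.finrank ℝ V := by
  obtain ⟨h1, h2⟩ := mgf_norm_sq_stdGaussian (E := V) ht
  rw [← map_orthogonalProjectionOnto_stdGaussian] at h1 h2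
  constructor
  · rwa [integrable_map_measure (by fun_prop) (by fun_prop)] at h1
  · rw [mgf, integral_map (by fun_prop) (by fun_prop)] at h2
    exact h2

/-- Upper tail of the chi-square distribution, from its moment generating function at `1/4`. -/
lemma stdGaussian_norm_sq_starProjection_ge (V : Submodule ℝ E) {m : ℕ}
    (hm : Module.finrank ℝ V ≤ m) (L : ℝ) :
    (stdGaussian E).real {x | 4 * (m + L) ≤ ‖V.starProjection x‖ ^ 2} ≤ Real.exp (-L) := by
  obtain ⟨h1, h2⟩ := mgf_norm_sq_starProjection_stdGaussian V (t := 1 / 4) (by norm_num)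
  refine (measure_ge_le_exp_mul_mgf _ (by norm_num : (0 : ℝ) ≤ 1 / 4) h1).trans ?_
  rw [h2]
  have hb : (√(1 - 2 * (1 / 4 : ℝ)))⁻¹ ≤ Real.exp 1 := by
    rw [← Real.sqrt_inv]
    refine (Real.sqrt_le_left (by norm_num)).2 ?_ |>.trans (Real.add_one_le_exp 1)
    norm_num
  calc _ ≤ Real.exp (-(1 / 4) * (4 * (m + L))) * Real.exp 1 ^ Module.finrank ℝ V := by gcongr
    _ ≤ Real.exp (-(1 / 4) * (4 * (m + L))) * Real.exp 1 ^ m := by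
        gcongr
        exact Real.one_le_exp (by norm_num)
    _ = Real.exp (-L) := by
        rw [← Real.exp_nat_mul, ← Real.exp_add]
        ring_nf

/-- Lower tail of the chi-square distribution, from its moment generating function at `-1/2`. -/
lemma stdGaussian_norm_sq_starProjection_le (V : Submodule ℝ E) {q : ℕ}
    (hq : q ≤ Module.finrank ℝ V) :
    (stdGaussian E).real {x | ‖V.starProjection x‖ ^ 2 ≤ q / 2} ≤ Real.exp (-(q / 12)) := by
  obtain ⟨h1, h2⟩ := mgf_norm_sq_starProjection_stdGaussian V (t := -1 / 2) (by norm_num)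
  refine (measure_le_le_exp_mul_mgf _ (by norm_num : (-1 / 2 : ℝ) ≤ 0) h1).trans ?_
  rw [h2]
  have hb : (√(1 - 2 * (-1 / 2 : ℝ)))⁻¹ = Real.exp (-(Real.log 2 / 2)) := by
    rw [Real.exp_neg, Real.sqrt_eq_rpow, Real.rpow_def_of_pos (by norm_num)]
    norm_num
    ring_nf
  rw [hb]
  calc _ ≤ Real.exp (-(-1 / 2) * (q / 2)) * Real.exp (-(Real.log 2 / 2)) ^ q := by
        refine mul_le_mul_of_nonneg_left ?_ (Real.exp_nonneg _)
        refine pow_le_pow_of_le_one (Real.exp_nonneg _) ?_ hq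
        exact Real.exp_le_one_iff.2 (by have := Real.log_nonneg (one_le_two (α := ℝ)); linarith)
    _ ≤ Real.exp (-(q / 12)) := by
        rw [← Real.exp_nat_mul, ← Real.exp_add]
        refine Real.exp_le_exp.2 ?_
        have := Real.log_two_gt_d9
        have hq0 : (0 : ℝ) ≤ q := q.cast_nonneg
        nlinarith

end stdGaussian

lemma pi_gaussianReal_eq_map {ι : Type*} [Fintype ι] (v : NNReal) :
    (Measure.pi fun _ : ι => gaussianReal 0 v)
      = (stdGaussian (EuclideanSpace ℝ ι)).map fun x => √v • x.ofLp := by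
  rw [← map_pi_eq_stdGaussian, Measure.map_map (by fun_prop) (by fun_prop)]
  have h : gaussianReal 0 v = (gaussianReal 0 1).map (fun x => √v * x) := by
    rw [gaussianReal_map_const_mul]
    congr 1
    · simp
    · ext
      simp
  rw [h, ← Measure.pi_map_pi fun _ => by fun_prop]
  rfl

/-- Upper tail for the squared norm of a projection of a centred Gaussian vector. -/
lemma pi_gaussianReal_norm_sq_starProjection_gt {ι : Type*} [Fintype ι] (v : NNReal)
    (V : Submodule ℝ (EuclideanSpace ℝ ι)) {m : ℕ} (hm : Module.finrank ℝ V ≤ m) (L : ℝ) :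
    (Measure.pi fun _ : ι => gaussianReal 0 v)
        {x | v * (4 * (m + L)) < ‖V.starProjection (WithLp.toLp 2 x)‖ ^ 2}
      ≤ ENNReal.ofReal (Real.exp (-L)) := by
  rw [pi_gaussianReal_eq_map, Measure.map_apply (by fun_prop)
    (measurableSet_lt (by fun_prop) (by fun_prop))]
  refine le_trans (measure_mono ?_) ((ENNReal.le_ofReal_iff_toReal_le (measure_ne_top _ _)
    (Real.exp_nonneg _)).2 (stdGaussian_norm_sq_starProjection_ge V hm L))
  intro x hx
  simp only [Set.mem_preimage, Set.mem_ofPred_eq, WithLp.toLp_smul, map_smul, norm_smul,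
    mul_pow, Real.norm_eq_abs, sq_abs, WithLp.toLp_ofLp] at hx ⊢
  rw [Real.sq_sqrt v.coe_nonneg] at hx
  exact (lt_of_mul_lt_mul_left hx v.coe_nonneg).le

/-- Lower tail for the squared norm of a projection of a centred Gaussian vector. -/
lemma pi_gaussianReal_norm_sq_starProjection_lt {ι : Type*} [Fintype ι] (v : NNReal)
    (V : Submodule ℝ (EuclideanSpace ℝ ι)) {q : ℕ} (hq : q ≤ Module.finrank ℝ V) :
    (Measure.pi fun _ : ι => gaussianReal 0 v)
        {x | ‖V.starProjection (WithLp.toLp 2 x)‖ ^ 2 < v * (q / 2)}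
      ≤ ENNReal.ofReal (Real.exp (-(q / 12))) := by
  rw [pi_gaussianReal_eq_map, Measure.map_apply (by fun_prop)
    (measurableSet_lt (by fun_prop) (by fun_prop))]
  refine le_trans (measure_mono ?_) ((ENNReal.le_ofReal_iff_toReal_le (measure_ne_top _ _)
    (Real.exp_nonneg _)).2 (stdGaussian_norm_sq_starProjection_le V hq))
  intro x hx
  simp only [Set.mem_preimage, Set.mem_ofPred_eq, WithLp.toLp_smul, map_smul, norm_smul,
    mul_pow, Real.norm_eq_abs, sq_abs, WithLp.toLp_ofLp] at hx ⊢
  rw [Real.sq_sqrt v.coe_nonneg] at hx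
  exact (lt_of_mul_lt_mul_left hx v.coe_nonneg).le

/-! ### Squared distance to a subspace -/

section sqDist

variable {F : Type*} [NormedAddCommGroup F] [InnerProductSpace ℝ F] [FiniteDimensional ℝ F]

/-- The squared distance of `y` to the subspace `K`, that is the residual sum of squares of the
least squares fit of `y` in `K`. -/
noncomputable def sqDist (K : Submodule ℝ F) (y : F) : ℝ := ‖y - K.starProjection y‖ ^ 2

lemma sqDist_nonneg (K : Submodule ℝ F) (y : F) : 0 ≤ sqDist K y := sq_nonneg _

lemma sqDist_eq_norm_sq_orthogonal (K : Submodule ℝ F) (y : F) :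
    sqDist K y = ‖Kᗮ.starProjection y‖ ^ 2 := by
  rw [sqDist, Submodule.starProjection_orthogonal']
  simp

lemma sqDist_add_of_mem {K : Submodule ℝ F} {μ : F} (hμ : μ ∈ K) (y : F) :
    sqDist K (μ + y) = sqDist K y := by
  rw [sqDist, sqDist, map_add, Submodule.starProjection_eq_self_iff.2 hμ]
  congr 2
  abel

lemma sqDist_le_norm_sq (K : Submodule ℝ F) (y : F) : sqDist K y ≤ ‖y‖ ^ 2 := by
  rw [sqDist_eq_norm_sq_orthogonal]
  gcongr
  exact Submodule.norm_starProjection_apply_le _ _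

lemma norm_sq_starProjection_sub {K₁ K : Submodule ℝ F} (h : K₁ ≤ K) (y : F) :
    ‖K.starProjection y - K₁.starProjection y‖ ^ 2 = sqDist K₁ y - sqDist K y := by
  have h1 : y - K₁.starProjection y
      = (y - K.starProjection y) + (K.starProjection y - K₁.starProjection y) := by abel
  have h2 : inner ℝ (y - K.starProjection y) (K.starProjection y - K₁.starProjection y) = 0 :=
    Submodule.starProjection_inner_eq_zero _ _ (K.sub_mem (K.starProjection_apply_mem y)
      (h (K₁.starProjection_apply_mem y)))
  rw [sqDist, sqDist, h1, norm_add_sq_real, h2]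
  ring

lemma sqDist_anti {K₁ K : Submodule ℝ F} (h : K₁ ≤ K) (y : F) : sqDist K y ≤ sqDist K₁ y := by
  have := norm_sq_starProjection_sub h y
  nlinarith [sq_nonneg ‖K.starProjection y - K₁.starProjection y‖]

lemma starProjection_orthogonal_inf {U K : Submodule ℝ F} (h : U ≤ K) (y : F) :
    (Uᗮ ⊓ K).starProjection y = K.starProjection y - U.starProjection y := by
  refine Submodule.eq_starProjection_of_mem_orthogonal ⟨?_, ?_⟩ ?_
  · have : K.starProjection y - U.starProjection y
        = (y - U.starProjection y) - (y - K.starProjection y) := by abel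
    rw [this]
    exact Submodule.sub_mem _ (U.sub_starProjection_mem_orthogonal y)
      (Submodule.orthogonal_le h (K.sub_starProjection_mem_orthogonal y))
  · exact K.sub_mem (K.starProjection_apply_mem y) (h (U.starProjection_apply_mem y))
  · have : y - (K.starProjection y - U.starProjection y)
        = (y - K.starProjection y) + U.starProjection y := by abel
    rw [this]
    refine Submodule.add_mem _ ?_ ?_
    · exact Submodule.orthogonal_le inf_le_right (K.sub_starProjection_mem_orthogonal y)
    · exact Submodule.orthogonal_le inf_le_left
        (Submodule.le_orthogonal_orthogonal U (U.starProjection_apply_mem y))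

/-- Enlarging the fitted space from `U` to `K` reduces the residual of `y` by the squared norm of its
projection on the orthogonal complement of `U` in `K`. -/
lemma sqDist_sub_sqDist {U K : Submodule ℝ F} (h : U ≤ K) (y : F) :
    sqDist U y - sqDist K y = ‖(Uᗮ ⊓ K).starProjection y‖ ^ 2 := by
  rw [starProjection_orthogonal_inf h, norm_sq_starProjection_sub h]

/-- A lower bound for the residual of signal `μ` plus noise `ε` after a fit in a space `K₁` that may
miss part of the signal. Both are compared inside a space `K` that contains `K₁` and `μ`; the
cross term is absorbed by `‖a + b‖² ≥ (3/4) ‖a‖² - 3 ‖b‖²`. -/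
lemma sqDist_add_ge {U K₁ K : Submodule ℝ F} (hU : U ≤ K₁) (hK : K₁ ≤ K) {μ : F} (hμ : μ ∈ K)
    (ε : F) :
    sqDist K ε + 3 / 4 * sqDist K₁ μ - 3 * (sqDist U ε - sqDist K ε) ≤ sqDist K₁ (μ + ε) := by
  have h1 := norm_sq_starProjection_sub hK (μ + ε)
  rw [sqDist_add_of_mem hμ] at h1
  have h2 := norm_sq_starProjection_sub hK ε
  have h3 := sqDist_anti hU ε
  -- `a` is the missed signal and `b` the noise that `K` fits and `K₁` does not
  set a := μ - K₁.starProjection μ with ha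
  set b := K.starProjection ε - K₁.starProjection ε with hb
  have h4 : K.starProjection (μ + ε) - K₁.starProjection (μ + ε) = a + b := by
    rw [map_add, map_add, Submodule.starProjection_eq_self_iff.2 hμ, ha, hb]
    abel
  rw [h4] at h1
  have h5 : sqDist K₁ μ = ‖a‖ ^ 2 := rfl
  -- this square is the weighted arithmetic-geometric mean bound on the cross term
  have h6 : 0 ≤ ‖a + (4 : ℝ) • b‖ ^ 2 := sq_nonneg _
  rw [norm_add_sq_real, inner_smul_right, norm_smul] at h6
  rw [norm_add_sq_real] at h1
  norm_num at h6
  nlinarith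

lemma finrank_orthogonal_inf_le {ι : Type*} [Fintype ι] {U K : Submodule ℝ F} (hUK : U ≤ K)
    (u : ι → F) (hK : K ≤ U ⊔ Submodule.span ℝ (Set.range u)) :
    Module.finrank ℝ (Uᗮ ⊓ K : Submodule ℝ F) ≤ Fintype.card ι := by
  have h1 := Submodule.finrank_add_inf_finrank_orthogonal hUK
  have h2 := Submodule.finrank_mono hK
  have h3 := Submodule.finrank_add_le_finrank_add_finrank U (Submodule.span ℝ (Set.range u))
  have h4 := finrank_range_le_card (R := ℝ) u
  rw [Set.finrank] at h4
  omega

lemma sqDist_lt_iff (K : Submodule ℝ F) (y : F) {c : ℝ} :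
    sqDist K y < c ↔ ∃ x ∈ K, ‖y - x‖ ^ 2 < c := by
  constructor
  · intro h
    exact ⟨_, K.starProjection_apply_mem y, h⟩
  · rintro ⟨x, hx, h⟩
    refine lt_of_le_of_lt ?_ h
    have := sqDist_add_of_mem (K.neg_mem hx) y
    rw [← this, neg_add_eq_sub]
    exact sqDist_le_norm_sq K _

/-- The squared distance to the span of a family depends measurably on the family, since its strict
sublevel sets are open. -/
lemma measurable_sqDist_span {ι : Type*} [Fintype ι] [MeasurableSpace F] [BorelSpace F] :
    Measurable fun p : (ι → F) × F => sqDist (Submodule.span ℝ (Set.range p.1)) p.2 := by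
  refine measurable_of_Iio fun c => IsOpen.measurableSet ?_
  have : (fun p : (ι → F) × F => sqDist (Submodule.span ℝ (Set.range p.1)) p.2) ⁻¹' Set.Iio c
      = ⋃ a : ι → ℝ, {p | ‖p.2 - ∑ i, a i • p.1 i‖ ^ 2 < c} := by
    ext p
    simp only [Set.mem_preimage, Set.mem_Iio, sqDist_lt_iff, Submodule.mem_span_range_iff_exists_fun,
      Set.mem_iUnion, Set.mem_ofPred_eq]
    constructor
    · rintro ⟨_, ⟨a, rfl⟩, h⟩
      exact ⟨a, h⟩
    · rintro ⟨a, h⟩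
      exact ⟨_, ⟨a, rfl⟩, h⟩
  rw [this]
  exact isOpen_iUnion fun a => isOpen_lt (by fun_prop) continuous_const

end sqDist

/-! ### The part of the signal that a candidate set misses -/

section design

variable {d : ℕ}

/-- If `a` is `A`-orthogonal to the coordinates in `T`, then the linear form `⟨x, a⟩` is uncorrelated
with these coordinates of `x ∼ N(0, A)`, hence independent of them. -/
lemma map_restrict_inner_multivariateGaussian {A : Matrix (Fin d) (Fin d) ℝ} (hA : A.PosSemidef)
    (T : Finset (Fin d)) (a : EuclideanSpace ℝ (Fin d)) (ha : ∀ j ∈ T, (A *ᵥ a.ofLp) j = 0) :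
    (multivariateGaussian 0 A).map (fun x => (fun j : T => x j, inner ℝ x a))
      = ((multivariateGaussian 0 A).map fun x => fun j : T => x j).prod
          (gaussianReal 0 (a.ofLp ⬝ᵥ A *ᵥ a.ofLp).toNNReal) := by
  set μ := multivariateGaussian (0 : EuclideanSpace ℝ (Fin d)) A with hμ
  have hcov : ∀ x y : EuclideanSpace ℝ (Fin d),
      cov[fun u => inner ℝ x u, fun u => inner ℝ y u; μ] = x.ofLp ⬝ᵥ A *ᵥ y.ofLp := by
    intro x y
    rw [← covarianceBilin_apply_eq_cov IsGaussian.memLp_two_id,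
      covarianceBilin_multivariateGaussian hA]
  have hcoord : ∀ j : Fin d, (fun u : EuclideanSpace ℝ (Fin d) => u j)
      = fun u => inner ℝ (EuclideanSpace.single j (1 : ℝ)) u := by
    intro j
    ext u
    rw [EuclideanSpace.inner_single_left]
    simp
  have hgauss : HasGaussianLaw (fun x : EuclideanSpace ℝ (Fin d) =>
      (fun j : T => x j, fun _ : Unit => inner ℝ a x)) μ := by
    have h0 : HasGaussianLaw id μ := IsGaussian.hasGaussianLaw_id
    exact h0.map_fun ((ContinuousLinearMap.pi fun j : T =>
      (EuclideanSpace.proj (j : Fin d) : EuclideanSpace ℝ (Fin d) →L[ℝ] ℝ)).prod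
      (ContinuousLinearMap.pi fun _ : Unit => innerSL ℝ a))
  have hind := hgauss.indepFun_of_covariance_eval (X := fun (j : T) x => x j)
    (Y := fun (_ : Unit) x => inner ℝ a x) (fun j _ => by
      rw [hcoord, hcov]
      simpa using ha j j.2)
  have hind' : IndepFun (fun x : EuclideanSpace ℝ (Fin d) => fun j : T => x j)
      (fun x => inner ℝ x a) μ := by
    have hψ : Measurable fun f : Unit → ℝ => f () := measurable_pi_apply ()
    have := hind.comp measurable_id hψ
    simpa [Function.comp_def, real_inner_comm] using this
  rw [(indepFun_iff_map_prod_eq_prod_map_map (by fun_prop) (by fun_prop)).1 hind']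
  congr 1
  have h1 := IsGaussian.map_eq_gaussianReal (μ := μ) (innerSL ℝ a)
  have h2 : Var[fun x => inner ℝ a x; μ] = a.ofLp ⬝ᵥ A *ᵥ a.ofLp := by
    rw [← covariance_self (by fun_prop), hcov]
  have h3 : ∫ x, (innerSL ℝ a) x ∂μ = 0 := by
    rw [(innerSL ℝ a).integral_comp_id_comm IsGaussian.integrable_id, hμ,
      integral_id_multivariateGaussian, map_zero]
  rw [h3] at h1
  simp only [coe_innerSL_apply] at h1
  rw [h2] at h1
  rw [← h1]
  congr 1
  ext x
  exact real_inner_comm _ _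

/-- If `a` is `A`-orthogonal to the coordinates in `T`, then `X a` is Gaussian noise independent of
the columns in `T`, so that its residual after projection on these columns is bounded below by the
chi-square lower tail. -/
lemma pi_multivariateGaussian_sqDist_lt {n : ℕ} {A : Matrix (Fin d) (Fin d) ℝ} (hA : A.PosSemidef)
    (T : Finset (Fin d)) (a : EuclideanSpace ℝ (Fin d)) (ha : ∀ j ∈ T, (A *ᵥ a.ofLp) j = 0)
    {q : ℕ} (hq : q + T.card ≤ n) {c : ℝ} (hc : c ≤ a.ofLp ⬝ᵥ A *ᵥ a.ofLp) :
    (Measure.pi fun _ : Fin n => multivariateGaussian 0 A)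
        {x | sqDist (columnSpace (Matrix.of fun i j => x i j) T)
          (WithLp.toLp 2 fun i => inner ℝ (x i) a) < c * (q / 2)}
      ≤ ENNReal.ofReal (Real.exp (-(q / 12))) := by
  set μ := multivariateGaussian (0 : EuclideanSpace ℝ (Fin d)) A with hμ
  set v := (a.ofLp ⬝ᵥ A *ᵥ a.ofLp).toNNReal with hv
  have hvc : c ≤ v := hc.trans (Real.le_coe_toNNReal _)
  set ν := μ.map fun x => fun j : T => x j with hν
  have : IsProbabilityMeasure ν := Measure.isProbabilityMeasure_map (by fun_prop)
  let span' : (Fin n → T → ℝ) → Submodule ℝ (EuclideanSpace ℝ (Fin n)) :=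
    fun M => Submodule.span ℝ (Set.range fun j : T => WithLp.toLp 2 fun i => M i j)
  let B : Set ((Fin n → T → ℝ) × (Fin n → ℝ)) :=
    {p | sqDist (span' p.1) (WithLp.toLp 2 p.2) < c * (q / 2)}
  have hB : MeasurableSet B := by
    refine measurableSet_lt ?_ measurable_const
    exact measurable_sqDist_span.comp (f := fun p : (Fin n → T → ℝ) × (Fin n → ℝ) =>
      (fun j : T => (WithLp.toLp 2 fun i => p.1 i j : EuclideanSpace ℝ (Fin n)),
        (WithLp.toLp 2 p.2 : EuclideanSpace ℝ (Fin n)))) (by fun_prop)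
  let f : EuclideanSpace ℝ (Fin d) → (T → ℝ) × ℝ := fun x => (fun j : T => x j, inner ℝ x a)
  have hf : Measurable f := by fun_prop
  have hmp1 : MeasurePreserving (fun (x : Fin n → EuclideanSpace ℝ (Fin d)) i => f (x i))
      (Measure.pi fun _ => μ) (Measure.pi fun _ => ν.prod (gaussianReal 0 v)) :=
    measurePreserving_pi _ _ fun _ =>
      ⟨hf, map_restrict_inner_multivariateGaussian hA T a ha⟩
  have hmp := (measurePreserving_arrowProdEquivProdArrow _ _ (Fin n) (fun _ => ν)
    (fun _ => gaussianReal 0 v)).comp hmp1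
  have hpre := hmp.measure_preimage hB.nullMeasurableSet
  refine le_trans (le_of_eq hpre) ?_
  rw [Measure.prod_apply hB]
  refine le_trans (lintegral_mono (g := fun _ => ENNReal.ofReal (Real.exp (-(q / 12))))
    fun M => ?_) (by simp)
  have hdim : q ≤ Module.finrank ℝ (span' M)ᗮ := by
    have h1 := Submodule.finrank_add_finrank_orthogonal (span' M)
    have h2 := finrank_range_le_card (R := ℝ)
      fun j : T => (WithLp.toLp 2 fun i => M i j : EuclideanSpace ℝ (Fin n))
    rw [Set.finrank, Fintype.card_coe] at h2
    rw [finrank_euclideanSpace_fin] at h1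
    have h3 : Module.finrank ℝ (span' M) ≤ T.card := h2
    omega
  refine le_trans (measure_mono ?_)
    (pi_gaussianReal_norm_sq_starProjection_lt v (span' M)ᗮ hdim)
  intro w hw
  have hw' : sqDist (span' M) (WithLp.toLp 2 w) < c * (q / 2) := hw
  rw [sqDist_eq_norm_sq_orthogonal] at hw'
  refine lt_of_lt_of_le hw' ?_
  gcongr

end design

section lambdaMin

/-- The variational lower bound for a quadratic form by its smallest eigenvalue. -/
lemma lambdaMin_mul_dotProduct_le {ι : Type*} [Fintype ι] [DecidableEq ι] {M : Matrix ι ι ℝ}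
    (hM : M.IsHermitian) {ω : ℝ} (hω : ω ≤ lambdaMin M) (x : ι → ℝ) :
    ω * (x ⬝ᵥ x) ≤ x ⬝ᵥ M *ᵥ x := by
  have hpsd : (M - algebraMap ℝ (Matrix ι ι ℝ) ω).PosSemidef := by
    rw [Matrix.posSemidef_iff_isHermitian_and_spectrum_nonneg]
    constructor
    · refine hM.sub ?_
      rw [Algebra.algebraMap_eq_smul_one, Matrix.IsHermitian]
      simp
    · intro s hs
      rw [sub_eq_add_neg, ← map_neg, add_comm, ← spectrum.vadd_eq, Set.mem_vadd_set] at hs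
      obtain ⟨t, ht, rfl⟩ := hs
      have hfin : (spectrum ℝ M).Finite := Matrix.finite_real_spectrum
      have := csInf_le hfin.bddBelow ht
      simp only [lambdaMin] at hω
      simp only [Set.mem_ofPred_eq, vadd_eq_add]
      linarith
  have := hpsd.dotProduct_mulVec_nonneg x
  simp only [star_trivial, Algebra.algebraMap_eq_smul_one, Matrix.sub_mulVec,
    Matrix.smul_mulVec, Matrix.one_mulVec, dotProduct_sub, dotProduct_smul, smul_eq_mul] at this
  linarith

end lambdaMin

section residual

variable {d : ℕ}

lemma isHermitian_condCov {A : Matrix (Fin d) (Fin d) ℝ} (hA : A.IsHermitian)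
    (S T : Finset (Fin d)) : (condCov A S T).IsHermitian := by
  have h : ∀ S T, (block A S T)ᴴ = block A T S := by
    intro S T
    rw [block, Matrix.conjTranspose_submatrix, hA.eq, block]
  rw [Matrix.IsHermitian, condCov, Matrix.conjTranspose_sub, Matrix.conjTranspose_mul,
    Matrix.conjTranspose_mul, Matrix.conjTranspose_nonsing_inv, h, h, h, h, Matrix.mul_assoc]

/-- The coefficients of the residual of `⟨x, β⟩` in its regression on the coordinates in `T`: they
agree with `β` off `T`, the residual is uncorrelated with the coordinates in `T`, and its variance
is bounded below through the conditional covariance. -/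
lemma exists_residual_coef {sbar : ℕ} {βmin ω : ℝ} {β : EuclideanSpace ℝ (Fin d)}
    (hβ : β ∈ coefClass d sbar βmin) {A : Matrix (Fin d) (Fin d) ℝ}
    (hA : A ∈ covClass d sbar ω) {T : Finset (Fin d)} (hT : T.card ≤ sbar) :
    ∃ a : EuclideanSpace ℝ (Fin d), (∀ j ∉ T, a j = β j) ∧ (∀ j ∈ T, (A *ᵥ a.ofLp) j = 0) ∧
      ω * βmin ^ 2 * (supp β \ T).card ≤ a.ofLp ⬝ᵥ A *ᵥ a.ofLp := by
  obtain ⟨hS, hmin, hβmin⟩ := hβ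
  obtain ⟨hpd, hcov, hω⟩ := hA
  set D := supp β \ T with hD
  have hTT : IsUnit (block A T T).det :=
    (Matrix.isUnit_iff_isUnit_det _).1 (hpd.submatrix Subtype.val_injective).isUnit
  let b : D → ℝ := fun j => β j
  let c : T → ℝ := (block A T T)⁻¹ *ᵥ (block A T D *ᵥ b)
  let a : EuclideanSpace ℝ (Fin d) :=
    WithLp.toLp 2 fun j => if h : j ∈ T then -c ⟨j, h⟩ else β j
  have haT : ∀ j : T, a j = -c j := fun j => by simp [a]
  have haD : ∀ j : D, a j = b j := fun j => by
    have := (Finset.mem_sdiff.1 j.2).2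
    simp [a, b, this]
  -- `a` is supported on the disjoint union of `D` and `T`
  have hsum : ∀ g : Fin d → ℝ, ∑ j, g j * a j = ∑ j : D, g j * b j - ∑ j : T, g j * c j := by
    intro g
    have hdisj : Disjoint D T := Finset.sdiff_disjoint
    rw [← Finset.sum_subset (Finset.subset_univ (D ∪ T)), Finset.sum_union hdisj,
      ← Finset.sum_coe_sort D, ← Finset.sum_coe_sort T, sub_eq_add_neg, ← Finset.sum_neg_distrib]
    · simp_rw [haT, haD, mul_neg]
    · intro j _ hj
      have hjT : j ∉ T := fun h => hj (Finset.mem_union_right _ h)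
      have hjS : j ∉ supp β := fun h =>
        hj (Finset.mem_union_left _ (Finset.mem_sdiff.2 ⟨h, hjT⟩))
      have : β j = 0 := by simpa [supp] using hjS
      simp [a, hjT, this]
  have hrow : ∀ (U : Finset (Fin d)) (i : U),
      (A *ᵥ a.ofLp) i = (block A U D *ᵥ b - block A U T *ᵥ c) i := by
    intro U i
    exact hsum fun j => A i j
  have hAT : ∀ j ∈ T, (A *ᵥ a.ofLp) j = 0 := by
    intro j hj
    rw [hrow T ⟨j, hj⟩]
    simp only [c]
    rw [Matrix.mulVec_mulVec, Matrix.mul_nonsing_inv _ hTT, Matrix.one_mulVec, sub_self]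
    rfl
  refine ⟨a, fun j hj => by simp [a, hj], hAT, ?_⟩
  have hquad : a.ofLp ⬝ᵥ A *ᵥ a.ofLp = b ⬝ᵥ condCov A D T *ᵥ b := by
    have h1 : ∀ i : D, (A *ᵥ a.ofLp) i = (condCov A D T *ᵥ b) i := by
      intro i
      rw [hrow D i, condCov, Matrix.sub_mulVec]
      simp only [c]
      rw [Matrix.mulVec_mulVec, Matrix.mulVec_mulVec, Matrix.mul_assoc]
    rw [dotProduct_comm]
    refine (hsum (A *ᵥ a.ofLp)).trans ?_
    rw [Finset.sum_eq_zero (s := Finset.univ (α := T)) fun j _ => by rw [hAT j j.2, zero_mul],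
      sub_zero, dotProduct_comm]
    exact Finset.sum_congr rfl fun i _ => by rw [h1 i]
  rw [hquad]
  rcases D.eq_empty_or_nonempty with hE | hE
  · have : IsEmpty D := by rw [hE]; infer_instance
    simp [hE, dotProduct]
  · have hnot : ¬ supp β ⊆ T := by
      rw [← Finset.sdiff_eq_empty_iff_subset]
      exact hE.ne_empty
    refine le_trans ?_ (lambdaMin_mul_dotProduct_le (isHermitian_condCov hpd.isHermitian D T)
      (hcov _ _ hS hT hnot) b)
    rw [mul_assoc]
    refine mul_le_mul_of_nonneg_left ?_ hω.le
    have hb : ∀ j : D, βmin ^ 2 ≤ b j * b j := by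
      intro j
      have := hmin j (Finset.mem_sdiff.1 j.2).1
      rw [← abs_mul_abs_self, ← pow_two]
      gcongr
    calc βmin ^ 2 * (D.card : ℝ) = ∑ _j : D, βmin ^ 2 := by simp [mul_comm]
      _ ≤ b ⬝ᵥ b := Finset.sum_le_sum fun j _ => hb j

end residual

/-! ### Counting candidate sets -/

section counting

lemma choose_le_choose_of_two_mul_le {d s j : ℕ} (hj : j ≤ s) (hs : 2 * s ≤ d) :
    d.choose j ≤ d.choose s := by
  induction s, hj using Nat.le_induction with
  | base => exact le_rfl
  | succ s _ ih =>
    exact (ih (by omega)).trans (Nat.choose_le_succ_of_lt_half_left (by omega))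

lemma two_pow_le_choose {d s : ℕ} (hs : 2 * s ≤ d) : 2 ^ s ≤ d.choose s := by
  refine le_trans ?_ (Nat.choose_le_choose s hs)
  rw [← Nat.centralBinom_eq_two_mul_choose]
  clear hs
  induction s with
  | zero => simp
  | succ s ih =>
    have := Nat.succ_mul_centralBinom_succ s
    rw [pow_succ]
    nlinarith

lemma card_filter_card_le {d s : ℕ} (hs : 2 * s ≤ d) :
    (Finset.univ.filter fun T : Finset (Fin d) => T.card ≤ s).card ≤ d.choose s ^ 2 := by
  have hsub : (Finset.univ.filter fun T : Finset (Fin d) => T.card ≤ s)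
      ⊆ (Finset.range (s + 1)).biUnion fun j => Finset.powersetCard j Finset.univ := by
    intro T hT
    simp only [Finset.mem_filter, Finset.mem_univ, true_and] at hT
    simp [Finset.mem_powersetCard]
    omega
  calc _ ≤ _ := Finset.card_le_card hsub
    _ ≤ ∑ j ∈ Finset.range (s + 1), (Finset.powersetCard j (Finset.univ : Finset (Fin d))).card :=
        Finset.card_biUnion_le
    _ ≤ ∑ _j ∈ Finset.range (s + 1), d.choose s := by
        refine Finset.sum_le_sum fun j hj => ?_
        rw [Finset.card_powersetCard, Finset.card_univ, Fintype.card_fin]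
        exact choose_le_choose_of_two_mul_le (Nat.lt_succ_iff.1 (Finset.mem_range.1 hj)) hs
    _ = (s + 1) * d.choose s := by simp
    _ ≤ d.choose s * d.choose s := by
        gcongr
        exact (Nat.lt_two_pow_self (n := s)).trans_le (two_pow_le_choose hs)
    _ = d.choose s ^ 2 := (sq _).symm

/-- Grouping the sets `T` by their symmetric difference with `S` turns this sum into a binomial
expansion. -/
lemma sum_pow_card_symmDiff {d : ℕ} (S : Finset (Fin d)) (x : ℝ) :
    ∑ T ∈ Finset.univ.erase S, x ^ (symmDiff S T).card = (1 + x) ^ d - 1 := by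
  have h1 : ∑ T : Finset (Fin d), x ^ (symmDiff S T).card = (1 + x) ^ d := by
    refine (Equiv.sum_comp ((symmDiff_right_involutive S).toPerm _)
      fun D : Finset (Fin d) => x ^ D.card).trans ?_
    simpa [add_comm] using Finset.sum_pow_mul_eq_add_pow x 1 (Finset.univ : Finset (Fin d))
  rw [← h1, ← Finset.add_sum_erase _ _ (Finset.mem_univ S)]
  simp

end counting

/-! ### The regression model as signal plus noise -/

section model

variable {n d : ℕ}

/-- The vector `X b` of the linear predictor with coefficients `b`, where `x` lists the rows
of `X`. -/
noncomputable def linPred (x : Fin n → EuclideanSpace ℝ (Fin d)) (b : EuclideanSpace ℝ (Fin d)) :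
    EuclideanSpace ℝ (Fin n) :=
  WithLp.toLp 2 fun i => inner ℝ (x i) b

/-- The column space of the design matrix with rows `x`, restricted to the columns in `S`. -/
def colSpan (x : Fin n → EuclideanSpace ℝ (Fin d)) (S : Finset (Fin d)) :
    Submodule ℝ (EuclideanSpace ℝ (Fin n)) :=
  columnSpace (Matrix.of fun i j => x i j) S

/-- The data set with covariates `x` and noise `ε`. -/
noncomputable def mkSample (β : EuclideanSpace ℝ (Fin d))
    (p : (Fin n → EuclideanSpace ℝ (Fin d)) × (Fin n → ℝ)) : Sample n d :=
  fun i => (p.1 i, inner ℝ (p.1 i) β + p.2 i)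

/-- The joint law of the covariates and the noise. -/
noncomputable def inputLaw (n : ℕ) (A : Matrix (Fin d) (Fin d) ℝ) (σ : ℝ) :
    Measure ((Fin n → EuclideanSpace ℝ (Fin d)) × (Fin n → ℝ)) :=
  (Measure.pi fun _ => multivariateGaussian 0 A).prod
    (Measure.pi fun _ => gaussianReal 0 (σ ^ 2).toNNReal)

instance (A : Matrix (Fin d) (Fin d) ℝ) (σ : ℝ) : IsProbabilityMeasure (inputLaw n A σ) := by
  unfold inputLaw
  infer_instance

lemma measurePreserving_mkSample (β : EuclideanSpace ℝ (Fin d)) (A : Matrix (Fin d) (Fin d) ℝ)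
    (σ : ℝ) : MeasurePreserving (mkSample (n := n) β) (inputLaw n A σ) (sampleLaw n β A σ) := by
  let g : EuclideanSpace ℝ (Fin d) × ℝ → EuclideanSpace ℝ (Fin d) × ℝ :=
    fun p => (p.1, inner ℝ p.1 β + p.2)
  have hg : Measurable g := by fun_prop
  have hprob : IsProbabilityMeasure (obsLaw β A σ) :=
    Measure.isProbabilityMeasure_map hg.aemeasurable
  have h1 : MeasurePreserving (fun (x : Fin n → EuclideanSpace ℝ (Fin d) × ℝ) i => g (x i))
      (Measure.pi fun _ => (multivariateGaussian 0 A).prod (gaussianReal 0 (σ ^ 2).toNNReal))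
      (Measure.pi fun _ => obsLaw β A σ) :=
    measurePreserving_pi _ _ fun _ => ⟨hg, rfl⟩
  exact h1.comp (measurePreserving_arrowProdEquivProdArrow _ _ (Fin n)
    (fun _ => multivariateGaussian 0 A) (fun _ => gaussianReal 0 (σ ^ 2).toNNReal)).symm

lemma linPred_sub_mem_colSpan (x : Fin n → EuclideanSpace ℝ (Fin d)) {a b : EuclideanSpace ℝ (Fin d)}
    {S : Finset (Fin d)} (h : ∀ j ∉ S, a j = b j) : linPred x a - linPred x b ∈ colSpan x S := by
  have : linPred x a - linPred x b
      = ∑ j : S, (a j - b j) • (WithLp.toLp 2 fun i => x i j : EuclideanSpace ℝ (Fin n)) := by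
    ext i
    have hs : ∑ j, (a j - b j) * x i j = ∑ j ∈ S, (a j - b j) * x i j :=
      (Finset.sum_subset (Finset.subset_univ S) fun j _ hj => by simp [h j hj]).symm
    simp only [linPred, PiLp.sub_apply, PiLp.inner_apply, WithLp.ofLp_sum, Finset.sum_apply,
      WithLp.ofLp_smul, Pi.smul_apply, smul_eq_mul]
    rw [Finset.sum_coe_sort S fun j => (a j - b j) * x i j, ← hs, ← Finset.sum_sub_distrib]
    refine Finset.sum_congr rfl fun j _ => ?_
    simp
    ring
  rw [this]
  exact Submodule.sum_mem _ fun j _ => Submodule.smul_mem _ _ (Submodule.subset_span ⟨j, rfl⟩)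

lemma linPred_mem_colSpan (x : Fin n → EuclideanSpace ℝ (Fin d)) {b : EuclideanSpace ℝ (Fin d)}
    {S : Finset (Fin d)} (h : ∀ j ∉ S, b j = 0) : linPred x b ∈ colSpan x S := by
  have h0 : linPred x 0 = 0 := by
    ext i
    simp [linPred]
  simpa [h0] using linPred_sub_mem_colSpan x (a := b) (b := 0) (by simpa using h)

lemma colSpan_mono (x : Fin n → EuclideanSpace ℝ (Fin d)) {S T : Finset (Fin d)} (h : S ⊆ T) :
    colSpan x S ≤ colSpan x T := by
  refine Submodule.span_mono ?_
  rintro _ ⟨j, rfl⟩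
  exact ⟨⟨j, h j.2⟩, rfl⟩

lemma sqDist_colSpan_congr (x : Fin n → EuclideanSpace ℝ (Fin d)) {a b : EuclideanSpace ℝ (Fin d)}
    {S : Finset (Fin d)} (h : ∀ j ∉ S, a j = b j) :
    sqDist (colSpan x S) (linPred x a) = sqDist (colSpan x S) (linPred x b) := by
  rw [← sqDist_add_of_mem (linPred_sub_mem_colSpan x h) (linPred x b), sub_add_cancel]

lemma objective_mkSample (τ : ℝ) (β : EuclideanSpace ℝ (Fin d))
    (p : (Fin n → EuclideanSpace ℝ (Fin d)) × (Fin n → ℝ)) (S : Finset (Fin d)) :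
    objective τ (mkSample β p) S
      = sqDist (colSpan p.1 S) (linPred p.1 β + WithLp.toLp 2 p.2) / ((n : ℝ) - S.card)
        + S.card * τ :=
  rfl

lemma finrank_colSpan_inf_le (x : Fin n → EuclideanSpace ℝ (Fin d)) (S T : Finset (Fin d)) :
    Module.finrank ℝ ((colSpan x (S ∩ T))ᗮ ⊓ colSpan x (S ∪ T) : Submodule ℝ _)
      ≤ (symmDiff S T).card := by
  rw [← Fintype.card_coe]
  refine finrank_orthogonal_inf_le (colSpan_mono x (by grind))
    (fun j : ↥(symmDiff S T) => (WithLp.toLp 2 fun i => x i j : EuclideanSpace ℝ (Fin n))) ?_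
  refine Submodule.span_le.2 ?_
  rintro _ ⟨⟨j, hj⟩, rfl⟩
  by_cases h : j ∈ S ∩ T
  · exact Submodule.mem_sup_left (Submodule.subset_span ⟨⟨j, h⟩, rfl⟩)
  · have h' : j ∈ symmDiff S T := by
      rw [Finset.mem_symmDiff]
      grind
    exact Submodule.mem_sup_right (Submodule.subset_span ⟨⟨j, h'⟩, rfl⟩)

lemma measurable_sqDist_colSpan (S : Finset (Fin d)) :
    Measurable fun p : (Fin n → EuclideanSpace ℝ (Fin d)) × (Fin n → ℝ) =>
      sqDist (colSpan p.1 S) (WithLp.toLp 2 p.2) :=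
  measurable_sqDist_span.comp (f := fun p : (Fin n → EuclideanSpace ℝ (Fin d)) × (Fin n → ℝ) =>
      (fun j : S => (WithLp.toLp 2 fun i => p.1 i j : EuclideanSpace ℝ (Fin n)),
        (WithLp.toLp 2 p.2 : EuclideanSpace ℝ (Fin n)))) (by fun_prop)

end model

/-! ### Exceptional events -/

section events

variable {n d : ℕ}

/-- The chi-square upper tail with `n` degrees of freedom, for the projection on the whole space. -/
lemma inputLaw_norm_noise (A : Matrix (Fin d) (Fin d) ℝ) (σ : ℝ) :
    inputLaw n A σ {p | 8 * σ ^ 2 * n < ‖(WithLp.toLp 2 p.2 : EuclideanSpace ℝ (Fin n))‖ ^ 2}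
      ≤ ENNReal.ofReal (Real.exp (-n)) := by
  have h := pi_gaussianReal_norm_sq_starProjection_gt (σ ^ 2).toNNReal
    (⊤ : Submodule ℝ (EuclideanSpace ℝ (Fin n))) (m := n) (by simp) n
  have hset : {p : (Fin n → EuclideanSpace ℝ (Fin d)) × (Fin n → ℝ) |
        8 * σ ^ 2 * n < ‖(WithLp.toLp 2 p.2 : EuclideanSpace ℝ (Fin n))‖ ^ 2}
      = Set.univ ×ˢ {e | (σ ^ 2).toNNReal * (4 * ((n : ℝ) + n))
        < ‖(⊤ : Submodule ℝ (EuclideanSpace ℝ (Fin n))).starProjection (WithLp.toLp 2 e)‖ ^ 2} := by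
    ext p
    simp only [Set.mem_prod, Set.mem_univ, true_and, Set.mem_ofPred_eq,
      Real.coe_toNNReal _ (sq_nonneg σ), Submodule.starProjection_top,
      ContinuousLinearMap.coe_id', id_eq]
    ring_nf
  rw [hset, inputLaw, Measure.prod_prod, measure_univ, one_mul]
  exact h

/-- The part of the noise that distinguishes the fits on `S` and on `T` lives, given the design, in
a space whose dimension is at most the size of the symmetric difference. -/
lemma inputLaw_noise_overlap (A : Matrix (Fin d) (Fin d) ℝ) (σ : ℝ) (S T : Finset (Fin d))
    (L : ℝ) :
    inputLaw n A σ {p | 4 * σ ^ 2 * ((symmDiff S T).card + L)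
        < sqDist (colSpan p.1 (S ∩ T)) (WithLp.toLp 2 p.2)
          - sqDist (colSpan p.1 (S ∪ T)) (WithLp.toLp 2 p.2)}
      ≤ ENNReal.ofReal (Real.exp (-L)) := by
  have hmeas : MeasurableSet {p : (Fin n → EuclideanSpace ℝ (Fin d)) × (Fin n → ℝ) |
      4 * σ ^ 2 * ((symmDiff S T).card + L) < sqDist (colSpan p.1 (S ∩ T)) (WithLp.toLp 2 p.2)
        - sqDist (colSpan p.1 (S ∪ T)) (WithLp.toLp 2 p.2)} :=
    measurableSet_lt measurable_const
      ((measurable_sqDist_colSpan _).sub (measurable_sqDist_colSpan _))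
  rw [inputLaw, Measure.prod_apply hmeas]
  refine le_trans (lintegral_mono (g := fun _ => ENNReal.ofReal (Real.exp (-L)))
    fun x => ?_) (by simp)
  refine le_trans (measure_mono ?_) (pi_gaussianReal_norm_sq_starProjection_gt (σ ^ 2).toNNReal
    _ (finrank_colSpan_inf_le x S T) L)
  intro e he
  simp only [Set.mem_preimage, Set.mem_ofPred_eq] at he ⊢
  rw [sqDist_sub_sqDist (colSpan_mono x (by grind))] at he
  rw [Real.coe_toNNReal _ (sq_nonneg σ)]
  convert he using 1
  ring

/-- Off `T` the coefficients `β` may be replaced by those of the regression residual, without a change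
of the distance to the columns in `T`. -/
lemma inputLaw_signal_lt {sbar : ℕ} {βmin ω : ℝ} {β : EuclideanSpace ℝ (Fin d)}
    (hβ : β ∈ coefClass d sbar βmin) {A : Matrix (Fin d) (Fin d) ℝ}
    (hA : A ∈ covClass d sbar ω) (σ : ℝ) {T : Finset (Fin d)} (hT : T.card ≤ sbar)
    (hTn : T.card ≤ n) :
    inputLaw n A σ {p | sqDist (colSpan p.1 T) (linPred p.1 β)
        < ω * βmin ^ 2 * (supp β \ T).card * (((n : ℝ) - T.card) / 2)}
      ≤ ENNReal.ofReal (Real.exp (-(((n : ℝ) - T.card) / 12))) := by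
  obtain ⟨a, hoff, hon, hvar⟩ := exists_residual_coef hβ hA hT
  have h := pi_multivariateGaussian_sqDist_lt (n := n) hA.1.posSemidef T a hon
    (q := n - T.card) (by omega) hvar
  rw [Nat.cast_sub hTn] at h
  have hset : {p : (Fin n → EuclideanSpace ℝ (Fin d)) × (Fin n → ℝ) |
        sqDist (colSpan p.1 T) (linPred p.1 β)
          < ω * βmin ^ 2 * (supp β \ T).card * (((n : ℝ) - T.card) / 2)}
      = {x | sqDist (colSpan x T) (linPred x a)
          < ω * βmin ^ 2 * (supp β \ T).card * (((n : ℝ) - T.card) / 2)} ×ˢ Set.univ := by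
    ext p
    simp [sqDist_colSpan_congr p.1 hoff]
  rw [hset, inputLaw, Measure.prod_prod, measure_univ, mul_one]
  exact h

end events

/-! ### Comparison of the objective values -/

section comparison

/-- The comparison of the two objective values in terms of the residual `R` common to both fits, the
noise overlap `N` and the missed signal `W`, for a candidate of size `t` that misses `k` of the `s`
true covariates and contains `m` others. -/
lemma objective_gap {n s t k m R N W τ σ ℓ : ℝ} (hn : 0 < n) (hs : 2 * s ≤ n) (ht : 2 * t ≤ n)
    (hk : 0 ≤ k) (hm : 0 ≤ m) (hkm : 0 < k + m) (hst : s + m = t + k)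
    (hR0 : 0 ≤ R) (hR : R ≤ 8 * σ ^ 2 * n) (hN0 : 0 ≤ N)
    (hN : N ≤ 4 * σ ^ 2 * ((k + m) * (1 + ℓ))) (hℓ : 0 ≤ ℓ)
    (hW : 2 * τ * k * (n - t) ≤ W) (hτ : 128 * σ ^ 2 * (1 + ℓ) < n * τ) :
    (R + N) / (n - s) + s * τ < (R + 3 / 4 * W - 3 * N) / (n - t) + t * τ := by
  have hs' : n / 2 ≤ n - s := by linarith
  have ht' : n / 2 ≤ n - t := by linarith
  have hps : 0 < n - s := by linarith
  have hpt : 0 < n - t := by linarith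
  have hW' : 2 * τ * k ≤ W / (n - t) := (le_div_iff₀ hpt).2 hW
  have hNs : N / (n - s) ≤ 2 * N / n := by
    rw [div_le_div_iff₀ hps hn]
    nlinarith
  have hNt : N / (n - t) ≤ 2 * N / n := by
    rw [div_le_div_iff₀ hpt hn]
    nlinarith
  have hRdiff : R / (n - s) - R / (n - t) ≤ 32 * σ ^ 2 * k / n := by
    have e : R / (n - s) - R / (n - t) = (R * (k - m)) / ((n - s) * (n - t)) := by
      have : k - m = s - t := by linarith
      rw [this]
      field_simp
      ring
    rw [e, div_le_div_iff₀ (mul_pos hps hpt) hn]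
    have h1 : n ^ 2 / 4 ≤ (n - s) * (n - t) := by nlinarith
    calc R * (k - m) * n ≤ R * k * n := by
          gcongr
          linarith
      _ ≤ (8 * σ ^ 2 * n) * k * n := by gcongr
      _ = 32 * σ ^ 2 * k * (n ^ 2 / 4) := by ring
      _ ≤ 32 * σ ^ 2 * k * ((n - s) * (n - t)) := by gcongr
  have hNn : 8 * N / n + 32 * σ ^ 2 * k / n < (k + m) * τ / 2 := by
    rw [← add_div, div_lt_iff₀ hn]
    have h1 : 32 * σ ^ 2 * k ≤ 32 * σ ^ 2 * ((k + m) * (1 + ℓ)) := by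
      gcongr
      nlinarith
    have h2 := mul_lt_mul_of_pos_left hτ hkm
    nlinarith
  have hτ0 : 0 < τ := by
    have : 0 ≤ 128 * σ ^ 2 * (1 + ℓ) := by positivity
    exact pos_of_mul_pos_right (this.trans_lt hτ) hn.le
  have e1 : (R + 3 / 4 * W - 3 * N) / (n - t)
      = R / (n - t) + 3 / 4 * (W / (n - t)) - 3 * (N / (n - t)) := by ring
  have e2 : (R + N) / (n - s) = R / (n - s) + N / (n - s) := by ring
  have e3 : 8 * N / n = 4 * (2 * N / n) := by ring
  rw [e1, e2]
  have e4 : s * τ = t * τ + k * τ - m * τ := by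
    rw [show s = t + k - m by linarith]
    ring
  have := mul_nonneg hm hτ0.le
  nlinarith

end comparison

/-! ### Support recovery -/

section recovery

variable {n d : ℕ}

/-- Outside the exceptional events the true support beats the candidate `T`. -/
lemma objective_supp_lt {sbar : ℕ} {βmin ω σ ℓ : ℝ} {β : EuclideanSpace ℝ (Fin d)}
    (hβ : β ∈ coefClass d sbar βmin) {T : Finset (Fin d)} (hT : T.card ≤ sbar)
    (hTS : T ≠ supp β) (hn : 0 < n) (hns : 2 * sbar ≤ n) (hℓ : 0 ≤ ℓ)
    (hτ : 128 * σ ^ 2 * (1 + ℓ) < n * (ω * βmin ^ 2 / 4))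
    {p : (Fin n → EuclideanSpace ℝ (Fin d)) × (Fin n → ℝ)}
    (h1 : ‖(WithLp.toLp 2 p.2 : EuclideanSpace ℝ (Fin n))‖ ^ 2 ≤ 8 * σ ^ 2 * n)
    (h2 : sqDist (colSpan p.1 (supp β ∩ T)) (WithLp.toLp 2 p.2)
        - sqDist (colSpan p.1 (supp β ∪ T)) (WithLp.toLp 2 p.2)
      ≤ 4 * σ ^ 2 * ((symmDiff (supp β) T).card + (symmDiff (supp β) T).card * ℓ))
    (h3 : ω * βmin ^ 2 * (supp β \ T).card * (((n : ℝ) - T.card) / 2)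
      ≤ sqDist (colSpan p.1 T) (linPred p.1 β)) :
    objective (ω * βmin ^ 2 / 4) (mkSample β p) (supp β)
      < objective (ω * βmin ^ 2 / 4) (mkSample β p) T := by
  rw [objective_mkSample, objective_mkSample]
  set S := supp β with hS
  set x := p.1
  set e : EuclideanSpace ℝ (Fin n) := WithLp.toLp 2 p.2
  have hScard : S.card ≤ sbar := hβ.1
  have hμ : linPred x β ∈ colSpan x S := linPred_mem_colSpan x fun j hj => by
    simpa [hS, supp] using hj
  have hUS : colSpan x (S ∩ T) ≤ colSpan x S := colSpan_mono x Finset.inter_subset_left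
  have hUT : colSpan x (S ∩ T) ≤ colSpan x T := colSpan_mono x Finset.inter_subset_right
  have hSK : colSpan x S ≤ colSpan x (S ∪ T) := colSpan_mono x Finset.subset_union_left
  have hTK : colSpan x T ≤ colSpan x (S ∪ T) := colSpan_mono x Finset.subset_union_right
  have hsymm : ((symmDiff S T).card : ℝ) = (S \ T).card + (T \ S).card := by
    rw [symmDiff_def, Finset.sup_eq_union, Finset.card_union_of_disjoint disjoint_sdiff_sdiff]
    push_cast
    rfl
  have hst : (S.card : ℝ) + (T \ S).card = T.card + (S \ T).card := by
    have h4 := Finset.card_sdiff_add_card S T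
    have h5 := Finset.card_sdiff_add_card T S
    rw [Finset.union_comm] at h5
    have : S.card + (T \ S).card = T.card + (S \ T).card := by omega
    exact_mod_cast this
  have hpos : (0 : ℝ) < (S \ T).card + (T \ S).card := by
    rw [← hsymm, Nat.cast_pos, Finset.card_pos, Finset.nonempty_iff_ne_empty]
    intro h
    exact hTS (symmDiff_eq_bot.1 h).symm
  have hnR : (0 : ℝ) < n := by exact_mod_cast hn
  have hs2 : 2 * (S.card : ℝ) ≤ n := by
    exact_mod_cast (show 2 * S.card ≤ n by omega)
  have ht2 : 2 * (T.card : ℝ) ≤ n := by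
    exact_mod_cast (show 2 * T.card ≤ n by omega)
  have hgap := objective_gap (R := sqDist (colSpan x (S ∪ T)) e)
    (N := sqDist (colSpan x (S ∩ T)) e - sqDist (colSpan x (S ∪ T)) e)
    (W := sqDist (colSpan x T) (linPred x β)) (τ := ω * βmin ^ 2 / 4) (σ := σ) (ℓ := ℓ)
    hnR hs2 ht2 (Nat.cast_nonneg _) (Nat.cast_nonneg _) hpos hst (sqDist_nonneg _ _)
    ((sqDist_le_norm_sq _ _).trans h1)
    (sub_nonneg.2 (sqDist_anti (hUS.trans hSK) e))
    (by rw [← hsymm]; convert h2 using 2; ring) hℓ (by convert h3 using 1; ring) hτ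
  refine lt_of_le_of_lt ?_ (lt_of_lt_of_le hgap ?_)
  · have hps : (0 : ℝ) < n - S.card := by linarith
    gcongr
    rw [sqDist_add_of_mem hμ]
    linarith [sqDist_anti hUS e]
  · have hpt : (0 : ℝ) < n - T.card := by linarith
    gcongr
    exact sqDist_add_ge hUT hTK (hSK hμ) e

/-- The event that the noise is too large, or that for some candidate set the noise overlap is too
large or the missed signal too small. -/
def exceptional (n sbar : ℕ) (βmin ω σ ℓ : ℝ) (β : EuclideanSpace ℝ (Fin d)) :
    Set ((Fin n → EuclideanSpace ℝ (Fin d)) × (Fin n → ℝ)) :=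
  {p | 8 * σ ^ 2 * n < ‖(WithLp.toLp 2 p.2 : EuclideanSpace ℝ (Fin n))‖ ^ 2} ∪
    ((⋃ T ∈ Finset.univ.erase (supp β),
      {p | 4 * σ ^ 2 * ((symmDiff (supp β) T).card + (symmDiff (supp β) T).card * ℓ)
        < sqDist (colSpan p.1 (supp β ∩ T)) (WithLp.toLp 2 p.2)
          - sqDist (colSpan p.1 (supp β ∪ T)) (WithLp.toLp 2 p.2)}) ∪
    ⋃ T ∈ Finset.univ.filter fun T : Finset (Fin d) => T.card ≤ sbar,
      {p | sqDist (colSpan p.1 T) (linPred p.1 β)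
        < ω * βmin ^ 2 * (supp β \ T).card * (((n : ℝ) - T.card) / 2)})

lemma one_add_div_pow_sub_one_le {δ : ℝ} (hδ : 0 < δ) (hδ1 : δ < 1) (hd : 0 < d) :
    (1 + δ / (6 * d)) ^ d - 1 ≤ δ / 3 := by
  have hdR : (0 : ℝ) < d := by exact_mod_cast hd
  have h1 : (1 + δ / (6 * d)) ^ d ≤ Real.exp (δ / 6) := by
    calc (1 + δ / (6 * d)) ^ d ≤ Real.exp (δ / (6 * d)) ^ d := by
          gcongr
          rw [add_comm]
          exact Real.add_one_le_exp _
      _ = Real.exp (δ / 6) := by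
          rw [← Real.exp_nat_mul]
          congr 1
          field_simp
  have h2 := Real.abs_exp_sub_one_le (x := δ / 6) (by rw [abs_of_pos (by positivity)]; linarith)
  rw [abs_of_pos (by positivity : 0 < δ / 6)] at h2
  have h3 := le_abs_self (Real.exp (δ / 6) - 1)
  linarith

/-- The union bound over the exceptional events. The noise overlap for `T` is given the failure
probability `(δ / 6d) ^ |S ∆ T|`, which sums to at most `δ / 3`. -/
lemma inputLaw_exceptional_le {sbar : ℕ} {βmin ω σ δ : ℝ} {β : EuclideanSpace ℝ (Fin d)}
    (hβ : β ∈ coefClass d sbar βmin) {A : Matrix (Fin d) (Fin d) ℝ} (hA : A ∈ covClass d sbar ω)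
    (hs : 2 * sbar ≤ d) (hd : 0 < d) (hδ : 0 < δ) (hδ1 : δ < 1) (hns : 2 * sbar ≤ n)
    (hn : 24 * (2 * Real.log (d.choose sbar) + Real.log (1 / δ) + Real.log 3) ≤ n) :
    inputLaw n A σ (exceptional n sbar βmin ω σ (Real.log (6 * d / δ)) β)
      ≤ ENNReal.ofReal δ := by
  have hdR : (0 : ℝ) < d := by exact_mod_cast hd
  have hchoose : (1 : ℝ) ≤ d.choose sbar := by
    exact_mod_cast Nat.choose_pos (by omega : sbar ≤ d)
  have hlog0 := Real.log_nonneg hchoose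
  have hδ3 : Real.exp (-(Real.log (1 / δ) + Real.log 3)) = δ / 3 := by
    rw [one_div, Real.log_inv, neg_add, neg_neg, Real.exp_add, Real.exp_log hδ, Real.exp_neg,
      Real.exp_log (by norm_num)]
    rfl
  have e1 : inputLaw n A σ
      {p | 8 * σ ^ 2 * n < ‖(WithLp.toLp 2 p.2 : EuclideanSpace ℝ (Fin n))‖ ^ 2}
      ≤ ENNReal.ofReal (δ / 3) := by
    refine (inputLaw_norm_noise A σ).trans (ENNReal.ofReal_le_ofReal ?_)
    rw [← hδ3]
    refine Real.exp_le_exp.2 ?_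
    have : 0 ≤ Real.log (1 / δ) := Real.log_nonneg (by rw [le_div_iff₀ hδ]; linarith)
    have : 0 ≤ Real.log 3 := Real.log_nonneg (by norm_num)
    linarith
  have e2 : inputLaw n A σ (⋃ T ∈ Finset.univ.erase (supp β),
      {p | 4 * σ ^ 2 * ((symmDiff (supp β) T).card
          + (symmDiff (supp β) T).card * Real.log (6 * d / δ))
        < sqDist (colSpan p.1 (supp β ∩ T)) (WithLp.toLp 2 p.2)
          - sqDist (colSpan p.1 (supp β ∪ T)) (WithLp.toLp 2 p.2)})
      ≤ ENNReal.ofReal (δ / 3) := by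
    refine (measure_biUnion_finset_le _ _).trans ?_
    refine (Finset.sum_le_sum fun T _ => inputLaw_noise_overlap A σ (supp β) T _).trans ?_
    rw [← ENNReal.ofReal_sum_of_nonneg fun _ _ => Real.exp_nonneg _]
    refine ENNReal.ofReal_le_ofReal (le_trans (le_of_eq ?_)
      (one_add_div_pow_sub_one_le (d := d) hδ hδ1 hd))
    rw [← sum_pow_card_symmDiff (supp β)]
    refine Finset.sum_congr rfl fun T _ => ?_
    rw [← mul_neg, Real.exp_nat_mul, Real.exp_neg, Real.exp_log (by positivity), inv_div]
  have e3 : inputLaw n A σ (⋃ T ∈ Finset.univ.filter fun T : Finset (Fin d) => T.card ≤ sbar,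
      {p | sqDist (colSpan p.1 T) (linPred p.1 β)
        < ω * βmin ^ 2 * (supp β \ T).card * (((n : ℝ) - T.card) / 2)})
      ≤ ENNReal.ofReal (δ / 3) := by
    refine (measure_biUnion_finset_le _ _).trans ?_
    have hT : ∀ T ∈ Finset.univ.filter fun T : Finset (Fin d) => T.card ≤ sbar,
        inputLaw n A σ {p | sqDist (colSpan p.1 T) (linPred p.1 β)
          < ω * βmin ^ 2 * (supp β \ T).card * (((n : ℝ) - T.card) / 2)}
        ≤ ENNReal.ofReal (Real.exp (-(n / 24))) := by
      intro T hT
      have hTc : T.card ≤ sbar := (Finset.mem_filter.1 hT).2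
      refine (inputLaw_signal_lt hβ hA σ hTc (by omega)).trans (ENNReal.ofReal_le_ofReal ?_)
      refine Real.exp_le_exp.2 ?_
      have : 2 * (T.card : ℝ) ≤ n := by exact_mod_cast (show 2 * T.card ≤ n by omega)
      linarith
    refine (Finset.sum_le_card_nsmul _ _ _ hT).trans ?_
    rw [nsmul_eq_mul, ← ENNReal.ofReal_natCast, ← ENNReal.ofReal_mul (Nat.cast_nonneg _)]
    refine ENNReal.ofReal_le_ofReal ?_
    have hcard : ((Finset.univ.filter fun T : Finset (Fin d) => T.card ≤ sbar).card : ℝ)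
        ≤ (d.choose sbar : ℝ) ^ 2 := by exact_mod_cast card_filter_card_le hs
    have hpow : (d.choose sbar : ℝ) ^ 2 = Real.exp (2 * Real.log (d.choose sbar)) := by
      rw [two_mul, Real.exp_add, Real.exp_log (by linarith), sq]
    calc _ ≤ (d.choose sbar : ℝ) ^ 2 * Real.exp (-(n / 24)) := by gcongr
      _ = Real.exp (2 * Real.log (d.choose sbar) - n / 24) := by
          rw [hpow, ← Real.exp_add, sub_eq_add_neg]
      _ ≤ Real.exp (-(Real.log (1 / δ) + Real.log 3)) := Real.exp_le_exp.2 (by linarith)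
      _ = δ / 3 := hδ3
  calc _ ≤ ENNReal.ofReal (δ / 3) + (ENNReal.ofReal (δ / 3) + ENNReal.ofReal (δ / 3)) :=
        (measure_union_le _ _).trans
          (add_le_add e1 ((measure_union_le _ _).trans (add_le_add e2 e3)))
    _ = ENNReal.ofReal δ := by
        rw [← ENNReal.ofReal_add (by positivity) (by positivity),
          ← ENNReal.ofReal_add (by positivity) (by positivity)]
        congr 1
        ring

instance (β : EuclideanSpace ℝ (Fin d)) (A : Matrix (Fin d) (Fin d) ℝ) (σ : ℝ) :
    IsProbabilityMeasure (sampleLaw n β A σ) := by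
  rw [← (measurePreserving_mkSample β A σ).map_eq]
  exact Measure.isProbabilityMeasure_map (measurePreserving_mkSample β A σ).aemeasurable

/-- The estimator equals the true support outside the exceptional event: there the true support is
the unique minimizer among the admissible sets. -/
lemma one_sub_le_of_exceptional {sbar : ℕ} {βmin ω σ δ ℓ : ℝ} {β : EuclideanSpace ℝ (Fin d)}
    (hβ : β ∈ coefClass d sbar βmin) {A : Matrix (Fin d) (Fin d) ℝ}
    {Shat : Sample n d → Finset (Fin d)} (hShat : IsBSSu sbar (ω * βmin ^ 2 / 4) Shat)
    (hn : 0 < n) (hns : 2 * sbar ≤ n) (hℓ : 0 ≤ ℓ)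
    (hτ : 128 * σ ^ 2 * (1 + ℓ) < n * (ω * βmin ^ 2 / 4)) (hδ : 0 ≤ δ)
    (hexc : inputLaw n A σ (exceptional n sbar βmin ω σ ℓ β) ≤ ENNReal.ofReal δ) :
    1 - δ ≤ (sampleLaw n β A σ).real {z | Shat z = supp β} := by
  have hmp := measurePreserving_mkSample (n := n) β A σ
  have hcover : (Set.univ : Set ((Fin n → EuclideanSpace ℝ (Fin d)) × (Fin n → ℝ)))
      ⊆ mkSample β ⁻¹' {z | Shat z = supp β} ∪ exceptional n sbar βmin ω σ ℓ β := by
    intro p _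
    by_contra hp
    rw [Set.mem_union, not_or] at hp
    obtain ⟨hne, hgood⟩ := hp
    obtain ⟨hcard, hmin⟩ := hShat.2 (mkSample β p)
    have hne' : Shat (mkSample β p) ≠ supp β := hne
    simp only [exceptional, Set.mem_union, Set.mem_iUnion, Set.mem_ofPred_eq, not_or, not_exists,
      not_lt, Finset.mem_erase, Finset.mem_filter, Finset.mem_univ, and_true, true_and] at hgood
    obtain ⟨h1, h2, h3⟩ := hgood
    exact absurd (hmin _ hβ.1) (not_le.2 (objective_supp_lt hβ hcard hne' hn hns hℓ hτ h1
      (h2 _ hne') (h3 _ hcard)))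
  have hle : (1 : ENNReal) ≤ sampleLaw n β A σ {z | Shat z = supp β} + ENNReal.ofReal δ := by
    calc (1 : ENNReal) = inputLaw n A σ Set.univ := measure_univ.symm
      _ ≤ _ := measure_mono hcover
      _ ≤ _ := measure_union_le _ _
      _ ≤ _ := by
        refine add_le_add ?_ hexc
        rw [← hmp.map_eq]
        exact Measure.le_map_apply hmp.aemeasurable _
  have := ENNReal.toReal_mono (by finiteness) hle
  rw [ENNReal.toReal_add (by finiteness) (by finiteness), ENNReal.toReal_ofReal hδ,
    ENNReal.toReal_one] at this
  rw [measureReal_def]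
  linarith

end recovery

end BestSubset

theorem mainTheorem1 :
    ∃ C : ℝ, 0 < C ∧
      ∀ (d sbar n : ℕ) (βmin ω σ δ : ℝ), 2 * sbar ≤ d → 0 < σ → 0 < δ → δ < 1 →
        C * max ((Real.log d + Real.log (1 / δ)) / (βmin ^ 2 * ω / σ ^ 2))
            (Real.log (d.choose sbar) + Real.log (1 / δ)) ≤ n →
        ∀ Shat : BestSubset.Sample n d → Finset (Fin d),
          BestSubset.IsBSSu sbar (ω * βmin ^ 2 / 4) Shat →
          ∀ β ∈ BestSubset.coefClass d sbar βmin, ∀ A ∈ BestSubset.covClass d sbar ω,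
            1 - δ ≤ (BestSubset.sampleLaw n β A σ).real {z | Shat z = BestSubset.supp β} := by
  -- any constant works that gives `n ≥ 768 (log d + log (1 / δ)) / (ω βmin² / 4σ²)` for the gap and
  -- `n ≥ 96 (log (d.choose sbar) + log (1 / δ))` for the union bound
  refine ⟨10000, by norm_num, ?_⟩
  intro d sbar n βmin ω σ δ hs hσ hδ hδ1 hC Shat hShat β hβ A hA
  rcases Nat.eq_zero_or_pos sbar with rfl | hspos
  · -- both sets are empty
    have h1 : BestSubset.supp β = ∅ := Finset.card_eq_zero.1 (Nat.le_zero.1 hβ.1)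
    have h2 : {z | Shat z = BestSubset.supp β} = Set.univ := by
      ext z
      simpa [h1] using (hShat.2 z).1
    rw [h2, probReal_univ]
    linarith
  have hβmin : 0 < βmin := hβ.2.2
  have hω : 0 < ω := hA.2.2
  have hd2 : (2 : ℝ) ≤ d := by exact_mod_cast (show 2 ≤ d by omega)
  have hlog2 := Real.log_two_gt_d9
  have hlogd : Real.log 2 ≤ Real.log d := Real.log_le_log (by norm_num) hd2
  have hlogδ : 0 < Real.log (1 / δ) := Real.log_pos (by rw [lt_div_iff₀ hδ]; linarith)
  have hchoose : sbar * Real.log 2 ≤ Real.log (d.choose sbar) := by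
    rw [← Real.log_pow]
    refine Real.log_le_log (by positivity) ?_
    exact_mod_cast BestSubset.two_pow_le_choose hs
  have hspos' : (1 : ℝ) ≤ sbar := by exact_mod_cast hspos
  have hlog3 : Real.log 3 ≤ 2 * Real.log 2 := by
    calc Real.log 3 ≤ Real.log (2 ^ 2) := Real.log_le_log (by norm_num) (by norm_num)
      _ = 2 * Real.log 2 := by simp
  have hlog6 : Real.log 6 ≤ 3 * Real.log 2 := by
    calc Real.log 6 ≤ Real.log (2 ^ 3) := Real.log_le_log (by norm_num) (by norm_num)
      _ = 3 * Real.log 2 := by simp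
  have hA1 : 10000 * ((Real.log d + Real.log (1 / δ)) / (βmin ^ 2 * ω / σ ^ 2)) ≤ n :=
    le_trans (by gcongr; exact le_max_left _ _) hC
  have hA2 : 10000 * (Real.log (d.choose sbar) + Real.log (1 / δ)) ≤ n :=
    le_trans (by gcongr; exact le_max_right _ _) hC
  have hchoose2 : Real.log 2 ≤ Real.log (d.choose sbar) := by nlinarith
  have hns : 2 * (sbar : ℝ) ≤ n := by nlinarith
  have hnpos : (0 : ℝ) < n := by linarith
  have hsignal : 10000 * (Real.log d + Real.log (1 / δ)) * σ ^ 2 ≤ n * (βmin ^ 2 * ω) := by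
    rw [← mul_div_assoc, div_div_eq_mul_div, div_le_iff₀ (by positivity)] at hA1
    exact hA1
  have hℓ : Real.log (6 * d / δ) = Real.log 6 + Real.log d + Real.log (1 / δ) := by
    rw [div_eq_mul_one_div, Real.log_mul (by positivity) (by positivity),
      Real.log_mul (by norm_num) (by positivity)]
  have hlog6' : 0 ≤ Real.log 6 := Real.log_nonneg (by norm_num)
  refine BestSubset.one_sub_le_of_exceptional hβ hShat (by exact_mod_cast hnpos)
    (by exact_mod_cast hns) (ℓ := Real.log (6 * d / δ)) (by rw [hℓ]; linarith) ?_ hδ.le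
    (BestSubset.inputLaw_exceptional_le hβ hA hs (by omega) hδ hδ1 (by exact_mod_cast hns)
      (by linarith))
  have h1 : 1 + Real.log (6 * d / δ) ≤ 6 * (Real.log d + Real.log (1 / δ)) := by
    rw [hℓ]
    linarith
  have hσ2 : 0 < σ ^ 2 := by positivity
  have h2 : 0 < (Real.log d + Real.log (1 / δ)) * σ ^ 2 := by
    refine mul_pos ?_ hσ2
    linarith
  have h3 := mul_le_mul_of_nonneg_left h1 hσ2.le
  linarith
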